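/- Let $D^p$ denote the standard PL $p$-disc, with boundary $S^{p-1}=\partial D^p$, and let $S^q$ denote the standard PL $q$-sphere. For any integers $p,q\ge 2$ and any integer $c$ there are PL embeddings $f:D^p\to\mathbb R^{p+q}$ and $g:S^q\to\mathbb R^{p+q}$ such that $$|f(D^p)\cap g(S^q)|=1,\qquad f(S^{p-1})\cap g(S^q)=\varnothing,$$ and the linking coefficient of $f|_{S^{p-1}}$ and $g$ is $c$. Here the linking coefficient of PL maps $u:S^{p-1}\to\mathbb R^{p+q}$ and $g:S^q\to\mathbb R^{p+q}$ with disjoint images is the algebraic number (the sum of the signs) of the intersection points of $F$ and $g$, where $F:D^p\to\mathbb R^{p+q}$ is any PL extension of $u$ in general position with $g$ (finitely many intersection points, all of them transversal); this number does not depend on the choice of $F$. -/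

import Mathlib

open Set Topology

/-- The standard PL disc `D^m = [-1,1]^m`: the closed unit ball of `ℝ^m` in the sup norm. -/
def plDisc (m : ℕ) : Set (Fin m → ℝ) := Metric.closedBall 0 1

/-- The boundary `∂[-1,1]^m` of the standard PL disc `D^m`, that is, the standard PL sphere
`S^{m-1}`: the unit sphere of `ℝ^m` in the sup norm. In particular `S^q` is `plSphere (q + 1)`. -/
def plSphere (m : ℕ) : Set (Fin m → ℝ) := Metric.sphere 0 1

/-- A convex polyhedron in `ℝ^m`: an intersection of finitely many closed half-spaces. -/
def IsConvexPolyhedron {m : ℕ} (P : Set (Fin m → ℝ)) : Prop :=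
  ∃ H : Set (((Fin m → ℝ) →ₗ[ℝ] ℝ) × ℝ), H.Finite ∧ P = {x | ∀ h ∈ H, h.1 x ≤ h.2}

/-- `f` is piecewise linear on `X`: the set `X` is a union of finitely many convex polyhedra, on
each of which `f` agrees with an affine map. (Such an `f` is continuous on `X`.) -/
def PLOn {m n : ℕ} (f : (Fin m → ℝ) → (Fin n → ℝ)) (X : Set (Fin m → ℝ)) : Prop :=
  ∃ C : Set (Set (Fin m → ℝ)), C.Finite ∧ ⋃₀ C = X ∧
    ∀ P ∈ C, IsConvexPolyhedron P ∧ ∃ A : (Fin m → ℝ) →ᵃ[ℝ] (Fin n → ℝ), EqOn f A P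

/-- `f` is a PL embedding of the compact polyhedron `X`: a piecewise linear injective map. -/
def PLEmbeddingOn {m n : ℕ} (f : (Fin m → ℝ) → (Fin n → ℝ)) (X : Set (Fin m → ℝ)) : Prop :=
  PLOn f X ∧ InjOn f X

/-- `t` is a positively oriented frame of the tangent space of `S^q = ∂[-1,1]^{q+1}` at a point `y`
interior to a facet. The sphere is oriented as the boundary of the cube by the rule `outward vector
first`; the vector `y` points out of the cube at `y`. The second condition forces `t` to be
linearly independent, so there is no such frame at a `y` that lies in two facets. -/
def IsOrientedTangentFrame {q : ℕ} (y : Fin (q + 1) → ℝ) (t : Fin q → Fin (q + 1) → ℝ) : Prop :=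
  (∀ i, ∀ᶠ s : ℝ in 𝓝 0, y + s • t i ∈ plSphere (q + 1)) ∧
    0 < (Matrix.of (Fin.cons y t : Fin (q + 1) → Fin (q + 1) → ℝ)).det

/-- The maps `F : D^p → ℝ^{p+q}` and `g : S^q → ℝ^{p+q}` have at `(x, y)` a transversal
intersection point of sign `e`: `F x = g y`, the map `F` is affine near `x` with linear part `A`,
the map `g` is affine near `y` with linear part `B`, and for a positive tangent frame `t` of `S^q`
at `y` the vectors `A e₁, …, A e_p, B t₁, …, B t_q` form a basis of `ℝ^{p+q}` whose orientation
(compared with the standard one) is `e = ±1`. -/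
def IsTransversalIntersection {p q : ℕ} (F : (Fin p → ℝ) → (Fin (p + q) → ℝ))
    (g : (Fin (q + 1) → ℝ) → (Fin (p + q) → ℝ)) (x : Fin p → ℝ) (y : Fin (q + 1) → ℝ)
    (e : ℤ) : Prop :=
  F x = g y ∧
  ∃ (A : (Fin p → ℝ) →ₗ[ℝ] (Fin (p + q) → ℝ)) (B : (Fin (q + 1) → ℝ) →ₗ[ℝ] (Fin (p + q) → ℝ))
    (t : Fin q → Fin (q + 1) → ℝ),
    (∀ᶠ x' in 𝓝 x, F x' = F x + A (x' - x)) ∧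
    (∀ᶠ y' in 𝓝[plSphere (q + 1)] y, g y' = g y + B (y' - y)) ∧
    IsOrientedTangentFrame y t ∧
    (Matrix.of (Fin.append (fun i => A (Pi.single i 1)) (fun j => B (t j)))).det ≠ 0 ∧
    e = (SignType.sign
      (Matrix.of (Fin.append (fun i => A (Pi.single i 1)) (fun j => B (t j)))).det : ℤ)

/-- `F : D^p → ℝ^{p+q}` is in general position with `g : S^q → ℝ^{p+q}`, and the algebraic number
of their intersection points is `c`: the set of all pairs `(x, y) ∈ D^p × S^q` with `F x = g y` is
finite, all these intersections are transversal, and their signs add up to `c`. -/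
def HasAlgebraicIntersection {p q : ℕ} (F : (Fin p → ℝ) → (Fin (p + q) → ℝ))
    (g : (Fin (q + 1) → ℝ) → (Fin (p + q) → ℝ)) (c : ℤ) : Prop :=
  ∃ (I : Finset ((Fin p → ℝ) × (Fin (q + 1) → ℝ)))
    (e : (Fin p → ℝ) × (Fin (q + 1) → ℝ) → ℤ),
    (∀ z, z ∈ I ↔ z.1 ∈ plDisc p ∧ z.2 ∈ plSphere (q + 1) ∧ F z.1 = g z.2) ∧
    (∀ z ∈ I, IsTransversalIntersection F g z.1 z.2 (e z)) ∧
    ∑ z ∈ I, e z = c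

/-- The linking coefficient of the PL maps `u : S^{p-1} → ℝ^{p+q}` and `g : S^q → ℝ^{p+q}` is
defined (that is, their images are disjoint) and equals `c`: it is the algebraic number of
intersection points of `g` with a PL singular disc `F : D^p → ℝ^{p+q}` spanned by `u` and in
general position with `g`. (This number is the same for all such `F`: it is the degree over `0`
of the map `(x, y) ↦ F x - g y` on `D^p × S^q`, which does not vanish on `S^{p-1} × S^q`.) -/
def HasLinkingCoefficient {p q : ℕ} (u : (Fin p → ℝ) → (Fin (p + q) → ℝ))
    (g : (Fin (q + 1) → ℝ) → (Fin (p + q) → ℝ)) (c : ℤ) : Prop :=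
  PLOn u (plSphere p) ∧ PLOn g (plSphere (q + 1)) ∧
  Disjoint (u '' plSphere p) (g '' plSphere (q + 1)) ∧
  ∃ F : (Fin p → ℝ) → (Fin (p + q) → ℝ),
    PLOn F (plDisc p) ∧ EqOn F u (plSphere p) ∧ HasAlgebraicIntersection F g c

/-! The disc is a cone that winds around a flat facet of the sphere.

Write a point of `D^p` as `x = (t, s, w)` and a point of `ℝ^{p+q}` as a pair in `ℝ^p × ℝ^q`. The
sphere `g` is the boundary of a box, one facet of which is the cube `[-1,1]^q` in `0 × ℝ^q`. The disc
`f x = (b x, (t/2, s/2, 0))` is a graph over its last coordinates and `w`, hence is embedded; it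
stays away from the other facets of the box, so it meets `g` exactly where `b x = 0`.

Let `m` be the homogeneous triangular wave `m (s, t) = min_{k < n} |s - 4 k t|` (`wave`). Up to
a linear change of the target, `b x = (m (s, t) - t, m (s - t, t) - t, w)`. As the ray `(s, t)`
turns through the upper half-plane, the first two coordinates of `b` run `n` times around the
origin, and they vanish at the origin only, since the zeros of the two waves interlace
(`eq_of_wave_eq`). So `f` and `g` have a single common point, at which `f` is not affine.

To find the linking coefficient, both waves are shifted by a small constant `ε` cut off towards the
boundary of the disc. The multiple point splits into the `n` transversal points `t = 2 ε`,
`s = (8 k + 1) ε`, `k < n`, at which the Jacobian matrix is triangular with determinant `δ`. Here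
`δ = ±1` is a sign put in front of one coordinate of `b`, so the linking coefficient is `n δ`.
-/

/-! ### Piecewise affine functions -/

/-- The notion `PLOn` with an arbitrary real vector space as the target: the set `X` is a finite
union of convex polyhedra, on each of which `f` agrees with an affine map. -/
def PiecewiseAffineOn {m : ℕ} {V : Type*} [AddCommGroup V] [Module ℝ V]
    (f : (Fin m → ℝ) → V) (X : Set (Fin m → ℝ)) : Prop :=
  ∃ C : Set (Set (Fin m → ℝ)), C.Finite ∧ ⋃₀ C = X ∧
    ∀ P ∈ C, IsConvexPolyhedron P ∧ ∃ A : (Fin m → ℝ) →ᵃ[ℝ] V, EqOn f A P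

lemma IsConvexPolyhedron.inter {m : ℕ} {P Q : Set (Fin m → ℝ)} (hP : IsConvexPolyhedron P)
    (hQ : IsConvexPolyhedron Q) : IsConvexPolyhedron (P ∩ Q) := by
  obtain ⟨H, hH, rfl⟩ := hP
  obtain ⟨K, hK, rfl⟩ := hQ
  refine ⟨H ∪ K, hH.union hK, ?_⟩
  ext x
  simp only [mem_inter_iff, mem_ofPred_eq, mem_union, or_imp, forall_and]

lemma isConvexPolyhedron_univ {m : ℕ} : IsConvexPolyhedron (univ : Set (Fin m → ℝ)) :=
  ⟨∅, finite_empty, by simp⟩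

lemma isConvexPolyhedron_le {m : ℕ} (a b : (Fin m → ℝ) →ᵃ[ℝ] ℝ) :
    IsConvexPolyhedron {x | a x ≤ b x} := by
  refine ⟨{(a.linear - b.linear, b 0 - a 0)}, finite_singleton _, ?_⟩
  ext x
  have ha := congrFun a.decomp x
  have hb := congrFun b.decomp x
  simp only [Pi.add_apply] at ha hb
  simp only [mem_ofPred_eq, mem_singleton_iff, forall_eq, LinearMap.sub_apply, ha, hb]
  constructor <;> intro h <;> linarith

lemma isConvexPolyhedron_plDisc (m : ℕ) : IsConvexPolyhedron (plDisc m) := by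
  refine ⟨range (fun i : Fin m => (LinearMap.proj i, (1 : ℝ))) ∪
    range (fun i : Fin m => (-LinearMap.proj i, (1 : ℝ))),
    (finite_range _).union (finite_range _), ?_⟩
  ext x
  simp only [plDisc, mem_closedBall_zero_iff, pi_norm_le_iff_of_nonneg zero_le_one,
    Real.norm_eq_abs, abs_le, mem_union, mem_range, mem_ofPred_eq, or_imp, forall_and,
    forall_exists_index, forall_apply_eq_imp_iff, LinearMap.proj_apply, LinearMap.neg_apply]
  rw [and_comm]
  simp only [neg_le]

namespace PiecewiseAffineOn

variable {m : ℕ} {V W : Type*} [AddCommGroup V] [Module ℝ V] [AddCommGroup W] [Module ℝ W]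
  {f g : (Fin m → ℝ) → V} {X Y : Set (Fin m → ℝ)}

lemma of_affine (A : (Fin m → ℝ) →ᵃ[ℝ] V) (hX : IsConvexPolyhedron X) :
    PiecewiseAffineOn A X :=
  ⟨{X}, finite_singleton _, sUnion_singleton _, by
    rintro P rfl
    exact ⟨hX, A, fun _ _ => rfl⟩⟩

lemma linear_comp (hf : PiecewiseAffineOn f X) (L : V →ₗ[ℝ] W) :
    PiecewiseAffineOn (fun x => L (f x)) X := by
  obtain ⟨C, hC, hX, h⟩ := hf
  refine ⟨C, hC, hX, fun P hP => ⟨(h P hP).1, ?_⟩⟩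
  obtain ⟨A, hA⟩ := (h P hP).2
  exact ⟨L.toAffineMap.comp A, fun x hx => by simp [hA hx]⟩

lemma congr (hf : PiecewiseAffineOn f X) (h : EqOn g f X) : PiecewiseAffineOn g X := by
  obtain ⟨C, hC, rfl, h'⟩ := hf
  refine ⟨C, hC, rfl, fun P hP => ⟨(h' P hP).1, ?_⟩⟩
  obtain ⟨A, hA⟩ := (h' P hP).2
  exact ⟨A, fun x hx => (h (mem_sUnion_of_mem hx hP)).trans (hA hx)⟩

/-- Two piecewise affine functions are affine on the pieces of a common subdivision. -/
lemma prodMk {g : (Fin m → ℝ) → W} (hf : PiecewiseAffineOn f X) (hg : PiecewiseAffineOn g Y) :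
    PiecewiseAffineOn (fun x => (f x, g x)) (X ∩ Y) := by
  obtain ⟨C, hC, rfl, hf⟩ := hf
  obtain ⟨D, hD, rfl, hg⟩ := hg
  refine ⟨image2 (· ∩ ·) C D, hC.image2 _ hD, ?_, ?_⟩
  · ext x
    simp only [mem_sUnion, mem_image2, mem_inter_iff]
    constructor
    · rintro ⟨_, ⟨P, hP, Q, hQ, rfl⟩, hx⟩
      exact ⟨⟨P, hP, hx.1⟩, Q, hQ, hx.2⟩
    · rintro ⟨⟨P, hP, h1⟩, Q, hQ, h2⟩
      exact ⟨_, ⟨P, hP, Q, hQ, rfl⟩, h1, h2⟩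
  · rintro _ ⟨P, hP, Q, hQ, rfl⟩
    obtain ⟨A, hA⟩ := (hf P hP).2
    obtain ⟨B, hB⟩ := (hg Q hQ).2
    exact ⟨(hf P hP).1.inter (hg Q hQ).1, A.prod B, fun x hx => by simp [hA hx.1, hB hx.2]⟩

lemma union (hX : PiecewiseAffineOn f X) (hY : PiecewiseAffineOn f Y) :
    PiecewiseAffineOn f (X ∪ Y) := by
  obtain ⟨C, hC, rfl, hf⟩ := hX
  obtain ⟨D, hD, rfl, hg⟩ := hY
  exact ⟨C ∪ D, hC.union hD, sUnion_union _ _, fun P hP => hP.elim (hf P) (hg P)⟩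

lemma biUnion {ι : Type*} {I : Set ι} (hI : I.Finite) {S : ι → Set (Fin m → ℝ)}
    (h : ∀ i ∈ I, PiecewiseAffineOn f (S i)) : PiecewiseAffineOn f (⋃ i ∈ I, S i) := by
  induction I, hI using Set.Finite.induction_on with
  | empty => exact ⟨∅, finite_empty, by simp, by simp⟩
  | insert _ _ ih =>
    rw [biUnion_insert]
    exact (h _ (mem_insert _ _)).union (ih fun i hi => h i (mem_insert_of_mem _ hi))

lemma inter (hf : PiecewiseAffineOn f X) (hg : PiecewiseAffineOn g Y) :
    PiecewiseAffineOn f (X ∩ Y) :=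
  (hf.prodMk hg).linear_comp (LinearMap.fst ℝ V V)

lemma add (hf : PiecewiseAffineOn f X) (hg : PiecewiseAffineOn g X) :
    PiecewiseAffineOn (fun x => f x + g x) X := by
  have h := (hf.prodMk hg).linear_comp (LinearMap.fst ℝ V V + LinearMap.snd ℝ V V)
  rw [inter_self] at h
  exact h

lemma smul (hf : PiecewiseAffineOn f X) (a : ℝ) : PiecewiseAffineOn (fun x => a • f x) X :=
  hf.linear_comp (a • LinearMap.id)

lemma sub (hf : PiecewiseAffineOn f X) (hg : PiecewiseAffineOn g X) :
    PiecewiseAffineOn (fun x => f x - g x) X :=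
  (hf.add (hg.smul (-1))).congr fun x _ => by simp [sub_eq_add_neg]

lemma max {f g : (Fin m → ℝ) → ℝ} (hf : PiecewiseAffineOn f X) (hg : PiecewiseAffineOn g X) :
    PiecewiseAffineOn (fun x => max (f x) (g x)) X := by
  have h := hf.prodMk hg
  rw [inter_self] at h
  obtain ⟨C, hC, rfl, h⟩ := h
  rw [sUnion_eq_biUnion]
  refine biUnion hC fun P hP => ?_
  obtain ⟨hP', A, hA⟩ := h P hP
  set a := (LinearMap.fst ℝ ℝ ℝ).toAffineMap.comp A
  set b := (LinearMap.snd ℝ ℝ ℝ).toAffineMap.comp A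
  have ha : ∀ x ∈ P, f x = a x := fun x hx => congrArg Prod.fst (hA hx)
  have hb : ∀ x ∈ P, g x = b x := fun x hx => congrArg Prod.snd (hA hx)
  have hcover : P = P ∩ {x | b x ≤ a x} ∪ P ∩ {x | a x ≤ b x} := by
    rw [← inter_union_distrib_left]
    exact (inter_eq_left.2 fun x _ => le_total (b x) (a x)).symm
  rw [hcover]
  refine union ?_ ?_
  · exact (of_affine a (hP'.inter (isConvexPolyhedron_le b a))).congr fun x hx => by
      simp only [ha x hx.1, hb x hx.1]
      exact max_eq_left hx.2
  · exact (of_affine b (hP'.inter (isConvexPolyhedron_le a b))).congr fun x hx => by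
      simp only [ha x hx.1, hb x hx.1]
      exact max_eq_right hx.2

lemma min {f g : (Fin m → ℝ) → ℝ} (hf : PiecewiseAffineOn f X) (hg : PiecewiseAffineOn g X) :
    PiecewiseAffineOn (fun x => min (f x) (g x)) X :=
  (((hf.smul (-1)).max (hg.smul (-1))).smul (-1)).congr fun x _ => by
    simp [max_neg_neg]

lemma abs {f : (Fin m → ℝ) → ℝ} (hf : PiecewiseAffineOn f X) :
    PiecewiseAffineOn (fun x => |f x|) X :=
  (hf.max (hf.smul (-1))).congr fun x _ => by simp [abs_eq_max_neg]

lemma const (v : V) : PiecewiseAffineOn (fun _ : Fin m → ℝ => v) univ :=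
  of_affine (AffineMap.const ℝ _ v) isConvexPolyhedron_univ

lemma coord (i : Fin m) : PiecewiseAffineOn (fun x : Fin m → ℝ => x i) univ :=
  of_affine (LinearMap.proj i : (Fin m → ℝ) →ₗ[ℝ] ℝ).toAffineMap isConvexPolyhedron_univ

lemma sum {ι : Type*} (I : Finset ι) {F : ι → (Fin m → ℝ) → V}
    (h : ∀ i, PiecewiseAffineOn (F i) univ) :
    PiecewiseAffineOn (fun x => ∑ i ∈ I, F i x) univ := by
  classical
  induction I using Finset.induction_on with
  | empty => simpa using const 0
  | insert i I hi ih => simpa only [Finset.sum_insert hi] using (h i).add ih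

lemma pi {n : ℕ} {F : (Fin m → ℝ) → (Fin n → ℝ)}
    (h : ∀ i, PiecewiseAffineOn (fun x => F x i) univ) : PiecewiseAffineOn F univ :=
  (sum Finset.univ fun i => (h i).linear_comp (LinearMap.single ℝ (fun _ => ℝ) i)).congr
    fun x _ => by simp [Finset.univ_sum_single]

end PiecewiseAffineOn

lemma PiecewiseAffineOn.plOn_plDisc {m n : ℕ} {f : (Fin m → ℝ) → (Fin n → ℝ)}
    (hf : PiecewiseAffineOn f univ) : PLOn f (plDisc m) := by
  have h := hf.inter (.of_affine (AffineMap.const ℝ _ 0) (isConvexPolyhedron_plDisc m))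
  rwa [univ_inter] at h

/-- The sphere `∂[-1,1]^m` is the union of the facets cut out of the cube by `1 ≤ ± x i`. -/
lemma PiecewiseAffineOn.plOn_plSphere {m n : ℕ} (hm : 0 < m) {f : (Fin m → ℝ) → (Fin n → ℝ)}
    (hf : PiecewiseAffineOn f univ) : PLOn f (plSphere m) := by
  have hS : plSphere m = ⋃ i ∈ (univ : Set (Fin m)), (plDisc m ∩ {x | 1 ≤ x i} ∪
      plDisc m ∩ {x | 1 ≤ -x i}) := by
    ext x
    have : Nonempty (Fin m) := ⟨⟨0, hm⟩⟩
    simp only [plSphere, plDisc, mem_sphere_zero_iff_norm, mem_univ, iUnion_true, mem_iUnion,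
      ← inter_union_distrib_left, mem_inter_iff, mem_closedBall_zero_iff, mem_union,
      mem_ofPred_eq, ← le_abs]
    constructor
    · intro h
      obtain ⟨i, hi⟩ := Finite.exists_max fun i => ‖x i‖
      exact ⟨i, h.le, h ▸ (pi_norm_le_iff_of_nonneg (norm_nonneg _)).2 hi⟩
    · rintro ⟨i, h1, h2⟩
      exact le_antisymm h1 (h2.trans (norm_le_pi_norm x i))
  have h0 := isConvexPolyhedron_plDisc m
  have key : PiecewiseAffineOn (fun _ : Fin m → ℝ => (0 : Fin n → ℝ)) (plSphere m) := by
    rw [hS]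
    refine .biUnion finite_univ fun i _ => .union ?_ ?_
    · exact .of_affine (AffineMap.const ℝ _ 0) (h0.inter (isConvexPolyhedron_le
        (AffineMap.const ℝ _ 1) (LinearMap.proj i : (Fin m → ℝ) →ₗ[ℝ] ℝ).toAffineMap))
    · exact .of_affine (AffineMap.const ℝ _ 0) (h0.inter (isConvexPolyhedron_le
        (AffineMap.const ℝ _ 1) (-LinearMap.proj i : (Fin m → ℝ) →ₗ[ℝ] ℝ).toAffineMap))
  have h := hf.inter key
  rwa [univ_inter] at h

/-! ### The homogeneous triangular wave -/

/-- The minimum of `|s - 4 k t|` over `k < n` and of `|s| + 2 |t|`. The latter serves as the value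
for `n = 0` and plays no role where one of the `|s - 4 k t|` is at most `2 t`. -/
def wave : ℕ → ℝ → ℝ → ℝ
  | 0, s, t => |s| + 2 * |t|
  | n + 1, s, t => min (wave n s t) |s - 4 * n * t|

lemma wave_nonneg (n : ℕ) (s t : ℝ) : 0 ≤ wave n s t := by
  induction n with
  | zero => simp only [wave]; positivity
  | succ n ih => exact le_min ih (abs_nonneg _)

lemma wave_le {n k : ℕ} (hk : k < n) (s t : ℝ) : wave n s t ≤ |s - 4 * k * t| := by
  induction n with
  | zero => omega
  | succ n ih =>
    rcases Nat.lt_succ_iff_lt_or_eq.1 hk with h | rfl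
    · exact (min_le_left _ _).trans (ih h)
    · exact min_le_right _ _

lemma wave_eq_or (n : ℕ) (s t : ℝ) :
    wave n s t = |s| + 2 * |t| ∨ ∃ k < n, wave n s t = |s - 4 * k * t| := by
  induction n with
  | zero => exact .inl rfl
  | succ n ih =>
    rcases min_choice (wave n s t) |s - 4 * n * t| with h | h
    · rcases ih with ih | ⟨k, hk, ih⟩
      · exact .inl (h.trans ih)
      · exact .inr ⟨k, hk.trans n.lt_succ_self, h.trans ih⟩
    · exact .inr ⟨n, n.lt_succ_self, h⟩

/-- Near the `k`-th of its zero rays, the wave is the distance to that ray. -/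
lemma wave_eq {n k : ℕ} (hk : k < n) {s t : ℝ} (h : |s - 4 * k * t| ≤ 2 * t) :
    wave n s t = |s - 4 * k * t| := by
  refine le_antisymm (wave_le hk s t) ?_
  have ht : 0 ≤ t := by linarith [abs_nonneg (s - 4 * k * t)]
  rcases wave_eq_or n s t with h' | ⟨j, -, h'⟩ <;> rw [h']
  · rw [abs_of_nonneg ht]
    linarith [abs_nonneg s]
  · have h2 := abs_le.1 h
    rcases lt_trichotomy j k with hjk | rfl | hjk
    · have hc : (j : ℝ) + 1 ≤ k := by exact_mod_cast hjk
      exact h.trans (le_abs.2 (.inl (by nlinarith)))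
    · exact le_rfl
    · have hc : (k : ℝ) + 1 ≤ j := by exact_mod_cast hjk
      exact h.trans (le_abs.2 (.inr (by nlinarith)))

/-- The points at which two waves, out of phase by a quarter of the period, are both equal to
`t - ε`. For `ε = 0` the only one is the origin; for `ε > 0` there is one for each `k < n`. -/
lemma eq_of_wave_eq {n : ℕ} {s t ε : ℝ} (hε : 0 ≤ ε) (h₁ : wave n s t = t - ε)
    (h₂ : wave n (s - t) t = t - ε) :
    (s = 0 ∧ t = 0 ∧ ε = 0) ∨ ∃ k < n, t = 2 * ε ∧ s = (8 * k + 1) * ε := by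
  have h0 := wave_nonneg n s t
  rcases (by linarith : 0 ≤ t).eq_or_lt with rfl | ht
  · have hε0 : ε = 0 := by linarith
    subst hε0
    refine .inl ⟨?_, rfl, rfl⟩
    rcases wave_eq_or n s 0 with h | ⟨k, -, h⟩ <;> simpa [h] using h₁
  right
  have hbase : ∀ r : ℝ, |r| + 2 * |t| ≠ t - ε := fun r h => by
    rw [abs_of_pos ht] at h
    linarith [abs_nonneg r]
  obtain ⟨k, hk, hk'⟩ := (wave_eq_or n s t).resolve_left (h₁ ▸ (hbase s).symm)
  obtain ⟨j, -, hj'⟩ := (wave_eq_or n (s - t) t).resolve_left (h₂ ▸ (hbase (s - t)).symm)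
  -- An inequality between integer multiples of `t` is one between integers.
  have hle : ∀ a b : ℤ, (a : ℝ) * t ≤ b * t → a ≤ b := fun a b h => by
    exact_mod_cast le_of_mul_le_mul_right h ht
  rcases eq_or_eq_neg_of_abs_eq (hk'.symm.trans h₁) with e₁ | e₁ <;>
    rcases eq_or_eq_neg_of_abs_eq (hj'.symm.trans h₂) with e₂ | e₂
  · have i₁ := hle (4 * k) (4 * j + 1) (by push_cast; linarith)
    have i₂ := hle (4 * j + 1) (4 * k) (by push_cast; linarith)
    omega
  · have i₁ := hle (4 * k) (4 * j + 1) (by push_cast; linarith)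
    have i₂ := hle (4 * j - 1) (4 * k) (by push_cast; linarith)
    obtain rfl : k = j := by omega
    have ht2 : t = 2 * ε := by linarith
    refine ⟨k, hk, ht2, ?_⟩
    rw [ht2] at e₁
    linarith
  · have i₁ := hle (4 * k) (4 * j + 3) (by push_cast; linarith)
    have i₂ := hle (4 * j + 1) (4 * k) (by push_cast; linarith)
    omega
  · have i₁ := hle (4 * k) (4 * j + 1) (by push_cast; linarith)
    have i₂ := hle (4 * j + 1) (4 * k) (by push_cast; linarith)
    omega

lemma PiecewiseAffineOn.wave {m : ℕ} {s t : (Fin m → ℝ) → ℝ} {X : Set (Fin m → ℝ)}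
    (hs : PiecewiseAffineOn s X) (ht : PiecewiseAffineOn t X) (n : ℕ) :
    PiecewiseAffineOn (fun x => wave n (s x) (t x)) X := by
  induction n with
  | zero => exact hs.abs.add (ht.abs.smul 2)
  | succ n ih => exact ih.min (hs.sub (ht.smul (4 * n))).abs

/-! ### The disc and the sphere -/

/-- The box boundary `g`: an affine map, which sends the facet `y 0 = 1` to `0 × [-1,1]^q` and
moves the other points in the direction of the second coordinate of `ℝ^p`. -/
def boxMap (p q : ℕ) (y : Fin (q + 2 + 1) → ℝ) : Fin (p + 2 + (q + 2)) → ℝ :=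
  Fin.append (Matrix.vecCons 0 (Matrix.vecCons (y 0 - 1) 0)) (fun j => y j.succ)

/-- The graph `x = (t, s, w) ↦ (b x, (t/2, s/2, 0))` whose first two coordinates wind `n` times
around the origin, in the direction given by `δ`; the waves are shifted by the function `h`. -/
noncomputable def windingDisc (p q n : ℕ) (δ : ℝ) (h : (Fin (p + 2) → ℝ) → ℝ) (x : Fin (p + 2) → ℝ) :
    Fin (p + 2 + (q + 2)) → ℝ :=
  Fin.append
    (Matrix.vecCons (δ * (2 * x 0 - wave n (x 1) (x 0) - wave n (x 1 - x 0) (x 0) - 2 * h x))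
      (Matrix.vecCons (wave n (x 1) (x 0) - x 0 + h x) (fun i : Fin p => x i.succ.succ)))
    (Matrix.vecCons (x 0 / 2) (Matrix.vecCons (x 1 / 2) 0))

lemma piecewiseAffineOn_boxMap (p q : ℕ) : PiecewiseAffineOn (boxMap p q) univ := by
  refine .pi fun i => ?_
  refine Fin.addCases (fun i => ?_) (fun j => ?_) i
  · simp only [boxMap, Fin.append_left]
    refine Fin.cases (.const 0) (fun i => ?_) i
    refine Fin.cases ((PiecewiseAffineOn.coord 0).sub (.const 1)) (fun i => ?_) i
    exact .const 0
  · simp only [boxMap, Fin.append_right]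
    exact .coord _

lemma piecewiseAffineOn_windingDisc (p q n : ℕ) (δ : ℝ) {h : (Fin (p + 2) → ℝ) → ℝ}
    (hh : PiecewiseAffineOn h univ) : PiecewiseAffineOn (windingDisc p q n δ h) univ := by
  have ht := PiecewiseAffineOn.coord (m := p + 2) 0
  have hs := PiecewiseAffineOn.coord (m := p + 2) 1
  refine .pi fun i => ?_
  refine Fin.addCases (fun i => ?_) (fun j => ?_) i
  · simp only [windingDisc, Fin.append_left]
    refine Fin.cases ?_ (fun i => Fin.cases ?_ (fun i => ?_) i) i
    · exact ((((ht.smul 2).sub (hs.wave ht n)).sub ((hs.sub ht).wave ht n)).sub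
        (hh.smul 2)).smul δ
    · exact ((hs.wave ht n).sub ht).add hh
    · exact .coord _
  · simp only [windingDisc, Fin.append_right]
    refine Fin.cases ?_ (fun j => Fin.cases ?_ (fun j => ?_) j) j
    · exact (ht.smul 2⁻¹).congr fun x _ => by simp [div_eq_inv_mul]
    · exact (hs.smul 2⁻¹).congr fun x _ => by simp [div_eq_inv_mul]
    · exact .const 0

lemma boxMap_injective (p q : ℕ) : Function.Injective (boxMap p q) := by
  intro y z h
  refine funext (Fin.cases ?_ fun j => ?_)
  · have := congrFun h (Fin.castAdd _ 1)
    simpa [boxMap] using this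
  · have := congrFun h (Fin.natAdd _ j)
    simpa [boxMap] using this

lemma windingDisc_injective (p q n : ℕ) (δ : ℝ) (h : (Fin (p + 2) → ℝ) → ℝ) :
    Function.Injective (windingDisc p q n δ h) := by
  intro x y hxy
  refine funext (Fin.cases ?_ fun i => Fin.cases ?_ (fun i => ?_) i)
  · have := congrFun hxy (Fin.natAdd _ 0)
    simp only [windingDisc, Fin.append_right, Matrix.cons_val_zero] at this
    linarith
  · have := congrFun hxy (Fin.natAdd _ 1)
    simp only [windingDisc, Fin.append_right, Matrix.cons_val_one, Matrix.cons_val_zero] at this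
    show x 1 = y 1
    linarith
  · have := congrFun hxy (Fin.castAdd _ i.succ.succ)
    simpa [windingDisc] using this

/-- The `k`-th point of the disc at which both waves, shifted by `ε`, vanish. -/
def windingPoint (p k : ℕ) (ε : ℝ) : Fin (p + 2) → ℝ :=
  Matrix.vecCons (2 * ε) (Matrix.vecCons ((8 * k + 1) * ε) 0)

/-- The point of the facet `y 0 = 1` whose image under `boxMap` is the image of `windingPoint`. -/
noncomputable def facetPoint (q k : ℕ) (ε : ℝ) : Fin (q + 2 + 1) → ℝ :=
  Matrix.vecCons 1 (Matrix.vecCons ε (Matrix.vecCons ((8 * k + 1) * ε / 2) 0))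

/-- A common point of the disc and the sphere lies on the facet `y 0 = 1`: the sides of the
box are too far away in the directions of `t` and `s`, and on the facet `y 0 = -1` the second
coordinate is `-2`, while on the disc it is at least `-1`. -/
lemma eq_of_windingDisc_eq_boxMap {p q n : ℕ} {δ : ℝ} (hδ : δ ≠ 0)
    {h : (Fin (p + 2) → ℝ) → ℝ} {x : Fin (p + 2) → ℝ} {y : Fin (q + 2 + 1) → ℝ} (hh : 0 ≤ h x)
    (hx : x ∈ plDisc (p + 2)) (hy : y ∈ plSphere (q + 2 + 1))
    (hxy : windingDisc p q n δ h x = boxMap p q y) :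
    (∀ i : Fin p, x i.succ.succ = 0) ∧
      y = Matrix.vecCons 1 (Matrix.vecCons (x 0 / 2) (Matrix.vecCons (x 1 / 2) 0)) ∧
      wave n (x 1) (x 0) = x 0 - h x ∧ wave n (x 1 - x 0) (x 0) = x 0 - h x := by
  have e0 := congrFun hxy (Fin.castAdd _ 0)
  have e1 := congrFun hxy (Fin.castAdd _ 1)
  have e2 := fun i : Fin p => congrFun hxy (Fin.castAdd _ i.succ.succ)
  have e3 := fun j : Fin (q + 2) => congrFun hxy (Fin.natAdd _ j)
  simp only [windingDisc, boxMap, Fin.append_left, Fin.append_right, Matrix.cons_val_zero,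
    Matrix.cons_val_one, Matrix.cons_val_succ, Pi.zero_apply] at e0 e1 e2 e3
  rw [plDisc, mem_closedBall_zero_iff, pi_norm_le_iff_of_nonneg zero_le_one] at hx
  rw [plSphere, mem_sphere_zero_iff_norm] at hy
  have hx0 := abs_le.1 (hx 0)
  have hx1 := abs_le.1 (hx 1)
  have htail : ∀ j : Fin (q + 2), |y j.succ| ≤ 1 / 2 := fun j => by
    rw [← e3 j]
    refine Fin.cases ?_ (fun j => Fin.cases ?_ (fun j => ?_) j) j
    · exact abs_le.2 ⟨by simp; linarith, by simp; linarith⟩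
    · exact abs_le.2 ⟨by simp; linarith, by simp; linarith⟩
    · simp
  have hy0 : y 0 = 1 := by
    have habs : 1 ≤ |y 0| := by
      by_contra! hlt
      refine hy.not_lt ?_
      rw [pi_norm_lt_iff one_pos]
      exact Fin.cases hlt fun j => (htail j).trans_lt (by norm_num)
    have hle : |y 0| ≤ 1 := hy ▸ norm_le_pi_norm y 0
    rcases eq_or_eq_neg_of_abs_eq (le_antisymm hle habs) with h1 | h1
    · exact h1
    · have := wave_nonneg n (x 1) (x 0)
      linarith
  have e0' := (mul_eq_zero.1 e0).resolve_left hδ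
  refine ⟨e2, funext (Fin.cases hy0 fun j => (e3 j).symm), by linarith, by linarith⟩

lemma eq_zero_of_windingDisc_eq_boxMap {p q n : ℕ} {δ : ℝ} (hδ : δ ≠ 0)
    {x : Fin (p + 2) → ℝ} {y : Fin (q + 2 + 1) → ℝ}
    (hx : x ∈ plDisc (p + 2)) (hy : y ∈ plSphere (q + 2 + 1))
    (hxy : windingDisc p q n δ (fun _ => 0) x = boxMap p q y) : x = 0 := by
  obtain ⟨hw, -, h1, h2⟩ := eq_of_windingDisc_eq_boxMap hδ le_rfl hx hy hxy
  have h0 : x 1 = 0 ∧ x 0 = 0 := by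
    rcases eq_of_wave_eq le_rfl h1 h2 with h | ⟨k, -, h, h'⟩
    · exact ⟨h.1, h.2.1⟩
    · simp [h, h']
  exact funext (Fin.cases h0.2 fun i => Fin.cases h0.1 hw i)

lemma windingDisc_zero (p q n : ℕ) (δ : ℝ) : windingDisc p q n δ (fun _ => 0) 0 = 0 := by
  have h : wave n 0 0 = 0 := by
    rcases wave_eq_or n 0 0 with h | ⟨k, -, h⟩ <;> simpa using h
  refine funext fun i => Fin.addCases (fun i => ?_) (fun j => ?_) i
  · simp only [windingDisc, Fin.append_left]
    refine Fin.cases ?_ (fun i => Fin.cases ?_ (fun i => ?_) i) i <;> simp [h]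
  · simp only [windingDisc, Fin.append_right]
    refine Fin.cases ?_ (fun i => Fin.cases ?_ (fun i => ?_) i) j <;> simp

lemma abs_windingPoint_lt (p : ℕ) {k : ℕ} {ε : ℝ} (hε : 0 ≤ ε) (h : (8 * k + 2) * ε < 1 / 2) :
    ∀ i, |windingPoint p k ε i| < 1 / 2 := by
  have hk : 0 ≤ k * ε := by positivity
  refine Fin.cases ?_ fun i => Fin.cases ?_ (fun i => ?_) i
  · exact abs_lt.2 ⟨by simp [windingPoint]; linarith, by simp [windingPoint]; linarith⟩
  · exact abs_lt.2 ⟨by simp [windingPoint]; linarith, by simp [windingPoint]; linarith⟩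
  · simp [windingPoint]

/-! ### Transversality at the split points -/

lemma mem_plSphere_of_facet {q : ℕ} {y : Fin (q + 1) → ℝ} (h0 : y 0 = 1)
    (h : ∀ j : Fin q, |y j.succ| ≤ 1) : y ∈ plSphere (q + 1) := by
  rw [plSphere, mem_sphere_zero_iff_norm]
  refine le_antisymm ((pi_norm_le_iff_of_nonneg zero_le_one).2 ?_) ?_
  · exact Fin.cases (by simp [h0]) h
  · simpa [h0] using norm_le_pi_norm y 0

/-- The coordinate vectors tangent to the facet `y 0 = 1` form a positive frame in its interior. -/
lemma isOrientedTangentFrame_facet {q : ℕ} {y : Fin (q + 1) → ℝ} (h0 : y 0 = 1)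
    (h : ∀ j : Fin q, |y j.succ| ≤ 1 / 2) :
    IsOrientedTangentFrame y (fun j => Pi.single j.succ 1) := by
  constructor
  · intro i
    filter_upwards [Metric.ball_mem_nhds (0 : ℝ) (by norm_num : (0 : ℝ) < 1 / 2)] with s hs
    rw [mem_ball_zero_iff, Real.norm_eq_abs] at hs
    refine mem_plSphere_of_facet (by simp [h0]) fun j => ?_
    have hj : |s * (Pi.single i.succ 1 : Fin (q + 1) → ℝ) j.succ| ≤ 1 / 2 := by
      by_cases hij : i = j
      · subst hij
        simpa using hs.le
      · rw [Pi.single_eq_of_ne (fun e => hij (Fin.succ_injective _ e.symm))]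
        simp
    exact (abs_add_le _ _).trans ((add_le_add (h j) hj).trans (by norm_num))
  · rw [Matrix.det_of_isUpperTriangular]
    · rw [Fin.prod_univ_succ]
      simp [h0]
    · intro i j hij
      refine Fin.cases (fun hij => absurd hij (Fin.not_lt_zero _)) (fun i hij => ?_) i hij
      exact Pi.single_eq_of_ne (ne_of_lt hij) _

/-- The linear part of `windingDisc` on the sector `4 k t ≤ s ≤ (4 k + 1) t`. -/
noncomputable def windingDiscLinear (p q k : ℕ) (δ : ℝ) :
    (Fin (p + 2) → ℝ) →ₗ[ℝ] (Fin (p + 2 + (q + 2)) → ℝ) where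
  toFun x := Fin.append
    (Matrix.vecCons (δ * x 0)
      (Matrix.vecCons (x 1 - (4 * k + 1) * x 0) (fun i : Fin p => x i.succ.succ)))
    (Matrix.vecCons (x 0 / 2) (Matrix.vecCons (x 1 / 2) 0))
  map_add' x y := by
    refine funext fun i => Fin.addCases (fun i => ?_) (fun j => ?_) i
    · simp only [Pi.add_apply, Fin.append_left]
      refine Fin.cases ?_ (fun i => Fin.cases ?_ (fun i => ?_) i) i <;> simp <;> ring
    · simp only [Pi.add_apply, Fin.append_right]
      refine Fin.cases ?_ (fun i => Fin.cases ?_ (fun i => ?_) i) j <;> simp <;> ring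
  map_smul' a x := by
    refine funext fun i => Fin.addCases (fun i => ?_) (fun j => ?_) i
    · simp only [Pi.smul_apply, Fin.append_left]
      refine Fin.cases ?_ (fun i => Fin.cases ?_ (fun i => ?_) i) i <;> simp <;> ring
    · simp only [Pi.smul_apply, Fin.append_right]
      refine Fin.cases ?_ (fun i => Fin.cases ?_ (fun i => ?_) i) j <;> simp <;> ring

/-- The linear part of the affine map `boxMap`. -/
def boxMapLinear (p q : ℕ) : (Fin (q + 2 + 1) → ℝ) →ₗ[ℝ] (Fin (p + 2 + (q + 2)) → ℝ) where
  toFun y := Fin.append (Matrix.vecCons 0 (Matrix.vecCons (y 0) 0)) (fun j => y j.succ)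
  map_add' x y := by
    refine funext fun i => Fin.addCases (fun i => ?_) (fun j => ?_) i
    · simp only [Pi.add_apply, Fin.append_left]
      refine Fin.cases ?_ (fun i => Fin.cases ?_ (fun i => ?_) i) i <;> simp
    · simp
  map_smul' a x := by
    refine funext fun i => Fin.addCases (fun i => ?_) (fun j => ?_) i
    · simp only [Pi.smul_apply, Fin.append_left]
      refine Fin.cases ?_ (fun i => Fin.cases ?_ (fun i => ?_) i) i <;> simp
    · simp

lemma boxMap_eq_add (p q : ℕ) (y z : Fin (q + 2 + 1) → ℝ) :
    boxMap p q z = boxMap p q y + boxMapLinear p q (z - y) := by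
  refine funext fun i => Fin.addCases (fun i => ?_) (fun j => ?_) i
  · simp only [boxMap, boxMapLinear, LinearMap.coe_mk, AddHom.coe_mk, Pi.add_apply,
      Fin.append_left]
    refine Fin.cases ?_ (fun i => Fin.cases ?_ (fun i => ?_) i) i <;> simp
  · simp [boxMap, boxMapLinear]

lemma windingDisc_eq_of_sector {p n k : ℕ} (q : ℕ) (hk : k < n) (δ : ℝ)
    (h : (Fin (p + 2) → ℝ) → ℝ) {x : Fin (p + 2) → ℝ} (h₁ : 0 ≤ x 1 - 4 * k * x 0)
    (h₂ : x 1 - 4 * k * x 0 ≤ x 0) :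
    windingDisc p q n δ h x = windingDiscLinear p q k δ x +
      Fin.append (Matrix.vecCons (-(2 * δ * h x)) (Matrix.vecCons (h x) 0)) 0 := by
  have e₁ : wave n (x 1) (x 0) = x 1 - 4 * k * x 0 := by
    rw [wave_eq hk] <;> rw [abs_of_nonneg h₁]
    linarith
  have e₂ : wave n (x 1 - x 0) (x 0) = x 0 - (x 1 - 4 * k * x 0) := by
    rw [wave_eq hk] <;> rw [abs_of_nonpos (by linarith)] <;> linarith
  refine funext fun i => Fin.addCases (fun i => ?_) (fun j => ?_) i
  · simp only [windingDisc, windingDiscLinear, LinearMap.coe_mk, AddHom.coe_mk, Pi.add_apply,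
      Fin.append_left, e₁, e₂]
    refine Fin.cases ?_ (fun i => Fin.cases ?_ (fun i => ?_) i) i <;> simp <;> ring
  · simp [windingDisc, windingDiscLinear]

/-- The differentials of the disc and of the facet together form a triangular matrix with diagonal
`δ, 1, …, 1`. -/
lemma det_windingDiscLinear_boxMapLinear (p q k : ℕ) (δ : ℝ) :
    (Matrix.of (Fin.append (fun i => windingDiscLinear p q k δ (Pi.single i 1))
      (fun j : Fin (q + 2) => boxMapLinear p q (Pi.single j.succ 1)))).det = δ := by
  rw [Matrix.det_of_isUpperTriangular]
  · rw [Fin.prod_univ_add, Fin.prod_univ_succ, Fin.prod_univ_succ]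
    simp [windingDiscLinear, boxMapLinear]
  · intro i j
    refine Fin.addCases (fun i => ?_) (fun i => ?_) i <;>
      refine Fin.addCases (fun j => ?_) (fun j => ?_) j <;> intro hij
    · simp only [Matrix.of_apply, Fin.append_left, windingDiscLinear, LinearMap.coe_mk,
        AddHom.coe_mk]
      have hij' : j < i := hij
      revert hij'
      refine Fin.cases ?_ (fun j => Fin.cases ?_ (fun j => ?_) j) j <;>
        refine Fin.cases ?_ (fun i => Fin.cases ?_ (fun i => ?_) i) i <;> intro hij'
      -- In each case the entry vanishes or lies on or above the diagonal.
      all_goals first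
        | (simp; done)
        | (simp at hij'; done)
        | (simp; exact Pi.single_eq_of_ne hij'.ne _)
    · exact absurd hij (by simp [Fin.lt_def]; omega)
    · simp only [Matrix.of_apply, Fin.append_left, Fin.append_right, boxMapLinear,
        LinearMap.coe_mk, AddHom.coe_mk]
      refine Fin.cases ?_ (fun j => Fin.cases ?_ (fun j => ?_) j) j <;> simp
    · simp only [Matrix.of_apply, Fin.append_right, boxMapLinear, LinearMap.coe_mk,
        AddHom.coe_mk]
      have hij' : j < i := by simpa using hij
      exact Pi.single_eq_of_ne (fun e => hij'.ne (Fin.succ_injective _ e)) _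

lemma facetPoint_abs_le (q : ℕ) {k : ℕ} {ε : ℝ} (hε : 0 ≤ ε) (h : (8 * k + 2) * ε ≤ 1 / 2) :
    ∀ j : Fin (q + 2), |facetPoint q k ε j.succ| ≤ 1 / 2 := by
  have hk : 0 ≤ k * ε := by positivity
  refine Fin.cases ?_ fun i => Fin.cases ?_ (fun i => ?_) i
  · exact abs_le.2 ⟨by simp [facetPoint]; linarith, by simp [facetPoint]; linarith⟩
  · exact abs_le.2 ⟨by simp [facetPoint]; linarith, by simp [facetPoint]; linarith⟩
  · simp [facetPoint]

lemma windingDisc_windingPoint {p n k : ℕ} (q : ℕ) (hk : k < n) (δ : ℝ) {ε : ℝ} (hε : 0 ≤ ε)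
    {h : (Fin (p + 2) → ℝ) → ℝ} (hh : h (windingPoint p k ε) = ε) :
    windingDisc p q n δ h (windingPoint p k ε) = boxMap p q (facetPoint q k ε) := by
  rw [windingDisc_eq_of_sector q hk, hh]
  · refine funext fun i => Fin.addCases (fun i => ?_) (fun j => ?_) i
    · simp only [windingDiscLinear, LinearMap.coe_mk, AddHom.coe_mk, Pi.add_apply, boxMap,
        Fin.append_left]
      refine Fin.cases ?_ (fun i => Fin.cases ?_ (fun i => ?_) i) i <;>
        simp [windingPoint, facetPoint] <;> ring
    · simp only [windingDiscLinear, LinearMap.coe_mk, AddHom.coe_mk, Pi.add_apply, boxMap,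
        Fin.append_right]
      refine Fin.cases ?_ (fun i => Fin.cases ?_ (fun i => ?_) i) j <;>
        simp [windingPoint, facetPoint]
  · simp [windingPoint]; linarith
  · simp [windingPoint]; linarith

lemma isTransversalIntersection_windingPoint {p n k : ℕ} (q : ℕ) (hk : k < n) {δ : ℝ} (hδ : δ ≠ 0)
    {ε : ℝ} (hε : 0 < ε) (hkε : (8 * k + 2) * ε ≤ 1 / 2) {h : (Fin (p + 2) → ℝ) → ℝ}
    (hh : ∀ᶠ x in 𝓝 (windingPoint p k ε), h x = ε) :
    IsTransversalIntersection (windingDisc p q n δ h) (boxMap p q) (windingPoint p k ε)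
      (facetPoint q k ε) (SignType.sign δ : ℤ) := by
  have hdet := det_windingDiscLinear_boxMapLinear p q k δ
  refine ⟨windingDisc_windingPoint q hk δ hε.le hh.self_of_nhds, windingDiscLinear p q k δ,
    boxMapLinear p q, fun j => Pi.single j.succ 1, ?_, .of_forall fun z => boxMap_eq_add p q _ z,
    isOrientedTangentFrame_facet rfl (facetPoint_abs_le q hε.le hkε), ?_, ?_⟩
  · have c₁ : Continuous fun x : Fin (p + 2) → ℝ => x 1 - 4 * k * x 0 := by fun_prop
    have c₂ : Continuous fun x : Fin (p + 2) → ℝ => x 0 := by fun_prop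
    have s₁ : 0 < windingPoint p k ε 1 - 4 * k * windingPoint p k ε 0 := by
      simp [windingPoint]; linarith
    have s₂ : windingPoint p k ε 1 - 4 * k * windingPoint p k ε 0 < windingPoint p k ε 0 := by
      simp [windingPoint]; linarith
    filter_upwards [hh, c₁.continuousAt.eventually_const_lt s₁,
      c₁.continuousAt.eventually_lt c₂.continuousAt s₂] with x hx hx₁ hx₂
    rw [windingDisc_eq_of_sector q hk δ h hx₁.le hx₂.le,
      windingDisc_eq_of_sector q hk δ h s₁.le s₂.le, hx, hh.self_of_nhds, map_sub]
    abel
  · rw [hdet]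
    exact hδ
  · rw [hdet]

/-! ### The cut-off and the linking coefficient -/

/-- A piecewise linear function on the cube, equal to `1` on the concentric cube of half the size
and to `0` on the boundary. -/
noncomputable def cutoff (p : ℕ) (x : Fin p → ℝ) : ℝ :=
  max 0 (1 - ∑ i, max 0 (2 * |x i| - 1))

lemma cutoff_nonneg (p : ℕ) (x : Fin p → ℝ) : 0 ≤ cutoff p x := le_max_left _ _

lemma cutoff_le_one (p : ℕ) (x : Fin p → ℝ) : cutoff p x ≤ 1 :=
  max_le zero_le_one (sub_le_self _ (Finset.sum_nonneg fun _ _ => le_max_left _ _))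

lemma cutoff_eq_one {p : ℕ} {x : Fin p → ℝ} (hx : ∀ i, |x i| ≤ 1 / 2) : cutoff p x = 1 := by
  have h : ∀ i, max 0 (2 * |x i| - 1) = 0 := fun i => max_eq_left (by linarith [hx i])
  simp [cutoff, h]

lemma cutoff_eq_zero {p : ℕ} (hp : 0 < p) {x : Fin p → ℝ} (hx : x ∈ plSphere p) :
    cutoff p x = 0 := by
  rw [plSphere, mem_sphere_zero_iff_norm] at hx
  have : Nonempty (Fin p) := ⟨⟨0, hp⟩⟩
  obtain ⟨i, hi⟩ := Finite.exists_max fun i => ‖x i‖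
  have h1 : 1 ≤ |x i| := hx ▸ (pi_norm_le_iff_of_nonneg (norm_nonneg _)).2 hi
  have h2 := Finset.single_le_sum (f := fun i => max 0 (2 * |x i| - 1))
    (fun _ _ => le_max_left _ _) (Finset.mem_univ i)
  have h3 := le_max_right 0 (2 * |x i| - 1)
  exact max_eq_left (by linarith)

lemma piecewiseAffineOn_cutoff (p : ℕ) : PiecewiseAffineOn (cutoff p) univ :=
  (PiecewiseAffineOn.const 0).max ((PiecewiseAffineOn.const 1).sub
    (.sum _ fun i => (PiecewiseAffineOn.const 0).max
      (((PiecewiseAffineOn.coord i).abs.smul 2).sub (.const 1))))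

lemma plSphere_subset_plDisc (p : ℕ) : plSphere p ⊆ plDisc p := Metric.sphere_subset_closedBall

lemma hasAlgebraicIntersection_windingDisc (p q n : ℕ) {δ : ℝ} (hδ : δ ≠ 0) {ε : ℝ} (hε : 0 < ε)
    (hnε : (8 * n + 2) * ε < 1 / 2) :
    HasAlgebraicIntersection (windingDisc p q n δ (fun x => ε * cutoff (p + 2) x)) (boxMap p q)
      (n * (SignType.sign δ : ℤ)) := by
  classical
  have hkε : ∀ k < n, (8 * k + 2) * ε < 1 / 2 := fun k hk =>
    lt_of_le_of_lt (by gcongr) hnε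
  have hone : ∀ k < n, cutoff (p + 2) (windingPoint p k ε) = 1 := fun k hk =>
    cutoff_eq_one fun i => (abs_windingPoint_lt p hε.le (hkε k hk) i).le
  have hinj : Function.Injective fun k : ℕ => (windingPoint p k ε, facetPoint q k ε) := by
    intro k j hkj
    have h := congrFun (congrArg Prod.fst hkj) 1
    simpa [windingPoint, hε.ne'] using h
  refine ⟨(Finset.range n).image fun k => (windingPoint p k ε, facetPoint q k ε),
    fun _ => (SignType.sign δ : ℤ), ?_, ?_, ?_⟩
  · rintro ⟨x, y⟩
    simp only [Finset.mem_image, Finset.mem_range, Prod.mk.injEq]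
    constructor
    · rintro ⟨k, hk, rfl, rfl⟩
      refine ⟨?_, mem_plSphere_of_facet rfl fun j =>
        (facetPoint_abs_le q hε.le (hkε k hk).le j).trans (by norm_num),
        windingDisc_windingPoint q hk δ hε.le (by rw [hone k hk, mul_one])⟩
      rw [plDisc, mem_closedBall_zero_iff, pi_norm_le_iff_of_nonneg zero_le_one]
      exact fun i => ((abs_windingPoint_lt p hε.le (hkε k hk) i).le).trans (by norm_num)
    · rintro ⟨hx, hy, hxy⟩
      have h0 : 0 ≤ ε * cutoff (p + 2) x := mul_nonneg hε.le (cutoff_nonneg _ _)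
      obtain ⟨hw, hy', h1, h2⟩ := eq_of_windingDisc_eq_boxMap hδ h0 hx hy hxy
      rcases eq_of_wave_eq h0 h1 h2 with ⟨hs, ht, hc⟩ | ⟨k, hk, ht, hs⟩
      · have hx0 : x = 0 := funext (Fin.cases ht fun i => Fin.cases hs hw i)
        rw [hx0, cutoff_eq_one (by simp)] at hc
        exact absurd hc (by simpa using hε.ne')
      · have hx' : x = windingPoint p k (ε * cutoff (p + 2) x) :=
          funext (Fin.cases ht fun i => Fin.cases hs hw i)
        -- All solutions lie in the half-size cube, where the cut-off is constant.
        have hc : cutoff (p + 2) x = 1 := by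
          have hle : ε * cutoff (p + 2) x ≤ ε := mul_le_of_le_one_right hε.le (cutoff_le_one _ _)
          refine cutoff_eq_one fun i => ?_
          rw [hx']
          exact (abs_windingPoint_lt p h0 ((mul_le_mul_of_nonneg_left hle
            (by positivity)).trans_lt (hkε k hk)) i).le
        rw [hc, mul_one] at hx' hs ht
        refine ⟨k, hk, hx'.symm, ?_⟩
        rw [hy', facetPoint, hs, ht, mul_div_cancel_left₀ ε two_ne_zero]
  · rintro z hz
    obtain ⟨k, hk, rfl⟩ := Finset.mem_image.1 hz
    have hk := Finset.mem_range.1 hk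
    refine isTransversalIntersection_windingPoint q hk hδ hε (hkε k hk).le ?_
    have hlt := abs_windingPoint_lt p hε.le (hkε k hk)
    have hev : ∀ᶠ x in 𝓝 (windingPoint p k ε), ∀ i, |x i| < 1 / 2 :=
      Filter.eventually_all.2 fun i =>
        ((continuous_apply i).abs.continuousAt).eventually_lt_const (hlt i)
    filter_upwards [hev] with x hx
    rw [cutoff_eq_one fun i => (hx i).le, mul_one]
  · rw [Finset.sum_const, Finset.card_image_of_injective _ hinj, Finset.card_range, nsmul_eq_mul]

theorem mainTheorem6 (p q : ℕ) (hp : 2 ≤ p) (hq : 2 ≤ q) (c : ℤ) :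
    ∃ (f : (Fin p → ℝ) → (Fin (p + q) → ℝ)) (g : (Fin (q + 1) → ℝ) → (Fin (p + q) → ℝ)),
      PLEmbeddingOn f (plDisc p) ∧
      PLEmbeddingOn g (plSphere (q + 1)) ∧
      (f '' plDisc p ∩ g '' plSphere (q + 1)).ncard = 1 ∧
      HasLinkingCoefficient f g c := by
  obtain ⟨p, rfl⟩ := Nat.exists_eq_add_of_le' hp
  obtain ⟨q, rfl⟩ := Nat.exists_eq_add_of_le' hq
  obtain ⟨n, δ, hδ, rfl⟩ : ∃ (n : ℕ) (δ : ℝ), δ ≠ 0 ∧ c = n * (SignType.sign δ : ℤ) := by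
    rcases Int.natAbs_eq c with h | h
    · exact ⟨c.natAbs, 1, one_ne_zero, by simpa using h⟩
    · exact ⟨c.natAbs, -1, by norm_num, by simpa using h⟩
  have hf := piecewiseAffineOn_windingDisc p q n δ (.const 0)
  have hg := piecewiseAffineOn_boxMap p q
  have hfi := windingDisc_injective p q n δ (fun _ => 0)
  refine ⟨windingDisc p q n δ (fun _ => 0), boxMap p q, ⟨hf.plOn_plDisc, hfi.injOn⟩,
    ⟨hg.plOn_plSphere (by omega), (boxMap_injective p q).injOn⟩, ?_,
    hf.plOn_plSphere (by omega), hg.plOn_plSphere (by omega), ?_, ?_⟩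
  · refine ncard_eq_one.2 ⟨0, Subset.antisymm ?_ ?_⟩
    · rintro _ ⟨⟨x, hx, rfl⟩, y, hy, hxy⟩
      rw [eq_zero_of_windingDisc_eq_boxMap hδ hx hy hxy.symm]
      exact windingDisc_zero p q n δ
    · rintro _ rfl
      refine ⟨⟨0, by simp [plDisc], windingDisc_zero p q n δ⟩, Pi.single 0 1,
        mem_plSphere_of_facet (by simp) (by simp), ?_⟩
      refine funext fun i => Fin.addCases (fun i => ?_) (fun j => ?_) i
      · simp only [boxMap, Fin.append_left]
        refine Fin.cases ?_ (fun i => Fin.cases ?_ (fun i => ?_) i) i <;> simp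
      · simp [boxMap]
  · rw [disjoint_left]
    rintro _ ⟨x, hx, rfl⟩ ⟨y, hy, hxy⟩
    have hx0 := eq_zero_of_windingDisc_eq_boxMap hδ (plSphere_subset_plDisc _ hx) hy hxy.symm
    simp [hx0, plSphere] at hx
  · set ε : ℝ := 1 / (16 * n + 8)
    have hε : 0 < ε := by positivity
    refine ⟨windingDisc p q n δ (fun x => ε * cutoff (p + 2) x),
      (piecewiseAffineOn_windingDisc p q n δ
        ((piecewiseAffineOn_cutoff _).smul ε)).plOn_plDisc, fun x hx => ?_,
      hasAlgebraicIntersection_windingDisc p q n hδ hε ?_⟩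
    · simp [windingDisc, cutoff_eq_zero (by omega : 0 < p + 2) hx]
    · rw [mul_one_div, div_lt_div_iff₀ (by positivity) two_pos]
      linarith
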